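/- A numerical semigroup is a subset $S\subseteq\mathbb{Z}_{\ge 0}$ that contains $0$, is closed under addition, and has finite complement. Its genus is $|\mathbb{Z}_{\ge 0}\setminus S|$, its multiplicity $m(S)$ is its smallest nonzero element, its atoms are the nonzero elements of $S$ that are not the sum of two nonzero elements of $S$, and its Apéry set is $\mathrm{Ap}(S)=\{x\in S : x-m(S)\notin S\}$. For a nonzero $x\in S$, the elasticity $\rho(x)$ is the largest number of atoms (counted with repetition) in an expression of $x$ as a sum of atoms, divided by the smallest such number; by convention $\rho(0)=1$. The semigroup $S$ is Apéry half-factorial (AHF) if $\max_{x\in\mathrm{Ap}(S)}\rho(x)=1$. For integers $m$ and $g$, let $n_{m,g}$ be the number of numerical semigroups of multiplicity $m$ and genus $g$, and let $h_{m,g}$ be the number of those that are AHF. **Theorem.** For each fixed $m\ge 2$, $$\lim_{g\to\infty}\frac{h_{m,g}}{n_{m,g}}=1.$$ -/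

import Mathlib

open Filter Topology

namespace NumSgp

/-- A numerical semigroup: a subset of `ℕ` that contains `0`, is closed under addition, and has
finite complement. -/
def IsNumericalSemigroup (S : AddSubmonoid ℕ) : Prop :=
  ((S : Set ℕ)ᶜ).Finite

/-- The multiplicity `m(S)`: the smallest nonzero element of `S`. -/
noncomputable def mult (S : AddSubmonoid ℕ) : ℕ :=
  sInf {x : ℕ | x ∈ S ∧ x ≠ 0}

/-- The genus `g(S)`: the number of elements of `ℕ` outside `S`. -/
noncomputable def genus (S : AddSubmonoid ℕ) : ℕ :=
  ((S : Set ℕ)ᶜ).ncard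

/-- The atoms of `S`: the nonzero elements of `S` that are not the sum of two nonzero elements
of `S`. -/
def atoms (S : AddSubmonoid ℕ) : Set ℕ :=
  {a | a ∈ S ∧ a ≠ 0 ∧ ∀ x ∈ S, ∀ y ∈ S, x ≠ 0 → y ≠ 0 → x + y ≠ a}

/-- The Apéry set of `S`: those `x ∈ S` with `x - m(S) ∉ S`, the difference being taken in `ℤ`. -/
def apery (S : AddSubmonoid ℕ) : Set ℕ :=
  {x | x ∈ S ∧ ¬ ∃ y ∈ S, (y : ℤ) = (x : ℤ) - (mult S : ℤ)}

/-- The factorizations of `x`: the finite multisets of atoms of `S` with sum `x`. -/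
def factorizations (S : AddSubmonoid ℕ) (x : ℕ) : Set (Multiset ℕ) :=
  {f | (∀ a ∈ f, a ∈ atoms S) ∧ f.sum = x}

/-- The lengths of `x`: the numbers of atoms, counted with multiplicity, in its factorizations. -/
def lengths (S : AddSubmonoid ℕ) (x : ℕ) : Set ℕ :=
  Multiset.card '' factorizations S x

/-- The elasticity `ρ(x)` of `x ∈ S`: the largest length divided by the smallest length. The set of
lengths of an `x ∈ S` is nonempty and bounded by `x`, so both exist. By convention `ρ(0) = 1`. -/
noncomputable def elasticity (S : AddSubmonoid ℕ) (x : ℕ) : ℚ :=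
  if x = 0 then 1 else (sSup (lengths S x) : ℕ) / (sInf (lengths S x) : ℕ)

/-- `S` is Apéry half-factorial: the maximum elasticity over the Apéry set of `S` is `1`. -/
def IsAHF (S : AddSubmonoid ℕ) : Prop :=
  IsGreatest (elasticity S '' apery S) 1

/-- `n_{m,g}`: the number of numerical semigroups of multiplicity `m` and genus `g`. -/
noncomputable def numSemigroups (m g : ℕ) : ℕ :=
  {S : AddSubmonoid ℕ | IsNumericalSemigroup S ∧ mult S = m ∧ genus S = g}.ncard

/-- `h_{m,g}`: the number of Apéry half-factorial numerical semigroups of multiplicity `m` and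
genus `g`. -/
noncomputable def numAHF (m g : ℕ) : ℕ :=
  {S : AddSubmonoid ℕ |
    IsNumericalSemigroup S ∧ mult S = m ∧ genus S = g ∧ IsAHF S}.ncard

end NumSgp

namespace NumSgp

/-! Write m = e + 2. A semigroup of multiplicity m is determined by its Kunz coordinates at the
nonzero residues, and their sum is the genus. So those of genus g are lattice points in a slice of
dimension e, namely the slice of the Kunz polyhedron cut out by that sum.

If S is not AHF, then some nonzero Apéry element is a sum of two others, which puts the coordinate
vector on a facet (`exists_onFacet_of_not_isAHF`). A facet loses one more dimension, so it carries
at most (g + 1)^(e - 1) points (`ncard_onFacet_mul_le`), and there are at most m^2 facets. On the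
other hand, nearly constant vectors satisfy all the Kunz inequalities and give at least a constant
times g^e semigroups for large g (`pow_le_numSemigroups`). The non-AHF proportion is therefore
O(1/g). -/

/-! ### Kunz coordinates and the genus -/

/-- The Kunz coordinate of `S` at the residue `t` modulo `m`: the least `k` with `k * m + t ∈ S`. -/
noncomputable def kunz (m : ℕ) (S : AddSubmonoid ℕ) (t : ℕ) : ℕ :=
  sInf {k : ℕ | k * m + t ∈ S}

theorem mult_mem {S : AddSubmonoid ℕ} (h : mult S ≠ 0) : mult S ∈ S := by
  have hne : {x : ℕ | x ∈ S ∧ x ≠ 0}.Nonempty := by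
    by_contra hE
    exact h (by rw [mult, Set.not_nonempty_iff_eq_empty.1 hE, Nat.sInf_empty])
  exact (Nat.sInf_mem hne).1

theorem mem_iff_kunz_le {m : ℕ} (hm : 0 < m) {S : AddSubmonoid ℕ}
    (hS : IsNumericalSemigroup S) (hmS : m ∈ S) (n : ℕ) : n ∈ S ↔ kunz m S (n % m) ≤ n / m := by
  have hdiv : n / m * m + n % m = n := Nat.div_add_mod' n m
  constructor
  · intro hn
    apply Nat.sInf_le
    rwa [Set.mem_ofPred_eq, hdiv]
  · intro h
    -- Finiteness of the complement enters here: over an empty set `sInf` would be 0, and the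
    -- inequality would say nothing.
    have hne : {k : ℕ | k * m + n % m ∈ S}.Nonempty := by
      have hfin : {k : ℕ | k * m + n % m ∈ S}ᶜ.Finite := by
        refine Set.Finite.preimage (f := fun k : ℕ => k * m + n % m) ?_ hS
        intro a _ b _ hab
        exact Nat.eq_of_mul_eq_mul_right hm (Nat.add_right_cancel hab)
      simpa using hfin.infinite_compl.nonempty
    have hmem : kunz m S (n % m) * m + n % m ∈ S := Nat.sInf_mem hne
    have h2 : (n / m - kunz m S (n % m)) * m ∈ S := by
      simpa using S.nsmul_mem hmS (n / m - kunz m S (n % m))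
    have h3 := S.add_mem h2 hmem
    rwa [← add_assoc, ← add_mul, Nat.sub_add_cancel h, hdiv] at h3

theorem kunz_zero (m : ℕ) (S : AddSubmonoid ℕ) : kunz m S 0 = 0 :=
  Nat.sInf_eq_zero.2 (Or.inl (by simp))

/-- The gaps in the class of t are k * m + t with k < c t. A general `c` serves both `kunz` and the
coordinates fed to `ofKunz`. -/
theorem ncard_compl_of_mem_iff {m : ℕ} (hm : 0 < m) {S : AddSubmonoid ℕ} {c : ℕ → ℕ}
    (hc : ∀ n, n ∈ S ↔ c (n % m) ≤ n / m) :
    ((S : Set ℕ)ᶜ).Finite ∧ ((S : Set ℕ)ᶜ).ncard = ∑ t ∈ Finset.range m, c t := by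
  have himg : ((S : Set ℕ)ᶜ) = (((Finset.range m).sigma fun t => Finset.range (c t)).image
      fun p : (_ : ℕ) × ℕ => p.2 * m + p.1 : Finset ℕ) := by
    ext n
    simp only [Set.mem_compl_iff, SetLike.mem_coe, hc, not_le, Finset.coe_image, Set.mem_image,
      Finset.mem_sigma, Finset.mem_range]
    constructor
    · intro h
      exact ⟨⟨n % m, n / m⟩, ⟨Nat.mod_lt _ hm, h⟩, Nat.div_add_mod' n m⟩
    · rintro ⟨⟨t, k⟩, ⟨ht, hk⟩, rfl⟩
      simp only at ht hk
      have h1 : (k * m + t) % m = t := by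
        rw [mul_comm, Nat.mul_add_mod, Nat.mod_eq_of_lt ht]
      have h2 : (k * m + t) / m = k := by
        rw [mul_comm, Nat.mul_add_div hm, Nat.div_eq_of_lt ht, add_zero]
      simpa only [h1, h2] using hk
  refine ⟨himg ▸ Finset.finite_toSet _, ?_⟩
  rw [himg, Set.ncard_coe_finset, Finset.card_image_of_injOn, Finset.card_sigma]
  · simp
  · rintro ⟨t, k⟩ h ⟨t', k'⟩ h' heq
    simp only [Finset.coe_sigma, Set.mem_sigma_iff, Finset.mem_coe, Finset.mem_range] at h h' heq
    have e1 := congrArg (· % m) heq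
    have e2 := congrArg (· / m) heq
    simp only [mul_comm _ m, Nat.mul_add_mod, Nat.mod_eq_of_lt h.1, Nat.mod_eq_of_lt h'.1] at e1
    simp only [mul_comm _ m, Nat.mul_add_div hm, Nat.div_eq_of_lt h.1, Nat.div_eq_of_lt h'.1,
      add_zero] at e2
    rw [e1, e2]

theorem genus_eq_sum_kunz {m : ℕ} (hm : 0 < m) {S : AddSubmonoid ℕ}
    (hS : IsNumericalSemigroup S) (hmS : m ∈ S) :
    genus S = ∑ t ∈ Finset.range m, kunz m S t :=
  (ncard_compl_of_mem_iff hm (mem_iff_kunz_le hm hS hmS)).2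

theorem eq_of_kunz_eq {m : ℕ} (hm : 0 < m) {S S' : AddSubmonoid ℕ}
    (hS : IsNumericalSemigroup S) (hmS : m ∈ S) (hS' : IsNumericalSemigroup S') (hmS' : m ∈ S')
    (h : ∀ t < m, kunz m S t = kunz m S' t) : S = S' := by
  ext n
  rw [mem_iff_kunz_le hm hS hmS, mem_iff_kunz_le hm hS' hmS', h _ (Nat.mod_lt _ hm)]

theorem kunz_le_genus {m t : ℕ} {S : AddSubmonoid ℕ} (ht : t < m)
    (hS : IsNumericalSemigroup S) (hmS : m ∈ S) : kunz m S t ≤ genus S := by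
  rw [genus_eq_sum_kunz (by omega) hS hmS]
  exact Finset.single_le_sum (f := kunz m S) (fun _ _ => Nat.zero_le _) (Finset.mem_range.2 ht)

/-! ### From failure of AHF to a facet -/

theorem elasticity_of_mem_atoms {S : AddSubmonoid ℕ} {x : ℕ} (hx : x ∈ atoms S) :
    elasticity S x = 1 := by
  have hlen : lengths S x = {1} := by
    ext l
    simp only [lengths, Set.mem_image, Set.mem_singleton_iff]
    constructor
    · rintro ⟨f, ⟨hf, hsum⟩, rfl⟩
      induction f using Multiset.induction_on with
      | empty => exact absurd hsum.symm hx.2.1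
      | cons a f _ =>
        rcases Multiset.empty_or_exists_mem f with rfl | ⟨b, hb⟩
        · simp
        · exfalso
          have hfS : f.sum ∈ S :=
            S.multiset_sum_mem f fun c hc => (hf c (Multiset.mem_cons_of_mem hc)).1
          have hb0 : b ≠ 0 := (hf b (Multiset.mem_cons_of_mem hb)).2.1
          have hle : b ≤ f.sum := Multiset.single_le_sum (fun _ _ => Nat.zero_le _) b hb
          have ha := hf a (Multiset.mem_cons_self a f)
          exact hx.2.2 a ha.1 f.sum hfS ha.2.1 (by omega) (by simpa using hsum)
    · rintro rfl
      exact ⟨{x}, ⟨by simpa using hx, by simp⟩, by simp⟩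
  simp [elasticity, hx.2.1, hlen]

theorem isAHF_of_forall_mem_atoms {S : AddSubmonoid ℕ} (hS : mult S ≠ 0)
    (h : ∀ x ∈ apery S, x ≠ 0 → x ∈ atoms S) : IsAHF S := by
  refine ⟨⟨0, ⟨S.zero_mem, ?_⟩, by simp [elasticity]⟩, ?_⟩
  · rintro ⟨y, _, hy⟩
    push_cast at hy
    omega
  · rintro _ ⟨x, hx, rfl⟩
    by_cases h0 : x = 0
    · simp [elasticity, h0]
    · exact (elasticity_of_mem_atoms (h x hx h0)).le

/-- A smaller Kunz coordinate would leave x - m in S. -/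
theorem kunz_mod_eq_div {S : AddSubmonoid ℕ} (hS : IsNumericalSemigroup S) (h0 : mult S ≠ 0)
    {x : ℕ} (hx : x ∈ apery S) : kunz (mult S) S (x % mult S) = x / mult S := by
  have hm : 0 < mult S := Nat.pos_of_ne_zero h0
  have hiff := mem_iff_kunz_le hm hS (mult_mem h0)
  refine le_antisymm ((hiff x).1 hx.1) ?_
  by_contra! hlt
  have hle : mult S ≤ x := by
    by_contra! hl
    rw [Nat.div_eq_of_lt hl] at hlt
    omega
  refine hx.2 ⟨x - mult S, (hiff _).2 ?_, by omega⟩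
  rw [← Nat.mod_eq_sub_mod hle]
  have : x / mult S = (x - mult S) / mult S + 1 := by rw [Nat.div_eq_sub_div hm hle]
  omega

/-- `S` lies on the facet of the Kunz polyhedron indexed by the residues `i` and `j`. -/
def OnFacet (m i j : ℕ) (S : AddSubmonoid ℕ) : Prop :=
  i ≠ 0 ∧ j ≠ 0 ∧ (i + j) % m ≠ 0 ∧
    kunz m S i + kunz m S j + (i + j) / m = kunz m S ((i + j) % m)

/-- Summands of an Apéry element are again Apéry elements, so in x = y + z all three quotients by m
are Kunz coordinates, and adding the quotients with carry gives the facet equation. -/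
theorem exists_onFacet_of_not_isAHF {S : AddSubmonoid ℕ} (hS : IsNumericalSemigroup S)
    (h0 : mult S ≠ 0) (h : ¬ IsAHF S) :
    ∃ i < mult S, ∃ j < mult S, OnFacet (mult S) i j S := by
  have hm : 0 < mult S := Nat.pos_of_ne_zero h0
  by_contra! hno
  refine h (isAHF_of_forall_mem_atoms h0 fun x hx hx0 => ⟨hx.1, hx0, ?_⟩)
  have apery_left : ∀ y ∈ S, ∀ z ∈ S, y + z = x → y ∈ apery S := by
    rintro y hy z hz hyz
    refine ⟨hy, ?_⟩
    rintro ⟨w, hw, hwy⟩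
    exact hx.2 ⟨w + z, S.add_mem hw hz, by push_cast; omega⟩
  have mod_ne : ∀ y ∈ apery S, y ≠ 0 → y % mult S ≠ 0 := by
    intro y hy hy0 hmod
    have h1 := kunz_mod_eq_div hS h0 hy
    rw [hmod, kunz_zero] at h1
    have h2 := Nat.div_add_mod' y (mult S)
    rw [hmod, ← h1] at h2
    omega
  intro y hy z hz hy0 hz0 hyz
  have hyA := apery_left y hy z hz hyz
  have hzA := apery_left z hz y hy (by omega)
  refine hno _ (Nat.mod_lt y hm) _ (Nat.mod_lt z hm)
    ⟨mod_ne y hyA hy0, mod_ne z hzA hz0, ?_, ?_⟩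
  · rw [← Nat.add_mod, hyz]
    exact mod_ne x hx hx0
  · rw [← Nat.add_mod, hyz, kunz_mod_eq_div hS h0 hyA, kunz_mod_eq_div hS h0 hzA,
      kunz_mod_eq_div hS h0 hx, ← Nat.mul_add_div hm, ← hyz]
    congr 1
    have h1 := Nat.div_add_mod y (mult S)
    have h2 := Nat.div_add_mod z (mult S)
    rw [mul_add]
    omega

/-! ### Upper bound for the non-AHF count -/

theorem finite_setOf_mult_genus {m : ℕ} (hm : m ≠ 0) (g : ℕ) :
    {S : AddSubmonoid ℕ | IsNumericalSemigroup S ∧ mult S = m ∧ genus S = g}.Finite := by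
  -- Reduction modulo g + 1 loses nothing, since each coordinate is at most g.
  refine Set.Finite.of_finite_image
    (f := fun S => fun t : Fin m => Fin.ofNat (g + 1) (kunz m S t)) (Set.toFinite _) ?_
  rintro S ⟨hS, rfl, hg⟩ S' ⟨hS', hmS', hg'⟩ heq
  have hmem' : mult S ∈ S' := hmS' ▸ mult_mem (hmS'.symm ▸ hm)
  refine eq_of_kunz_eq (Nat.pos_of_ne_zero hm) hS (mult_mem hm) hS' hmem' fun t ht => ?_
  have h1 := congrArg Fin.val (congrFun heq ⟨t, ht⟩)
  have h2 := kunz_le_genus ht hS (mult_mem hm)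
  have h3 := kunz_le_genus ht hS' hmem'
  simpa [Fin.ofNat, Nat.mod_eq_of_lt (show kunz (mult S) S t < g + 1 by omega),
    Nat.mod_eq_of_lt (show kunz (mult S) S' t < g + 1 by omega)] using h1

/-- With k = (i + j) % m, the coordinates outside 0, i, k determine S: the genus fixes the sum of
those at i and k, and the facet equation is independent of this, also when j = i. The factor g + 1
on the left avoids the exponent e - 1 at e = 0. -/
theorem ncard_onFacet_mul_le {e i j : ℕ} (hi : i < e + 2) (hj : j < e + 2) (g : ℕ) :
    {S : AddSubmonoid ℕ | (IsNumericalSemigroup S ∧ mult S = e + 2 ∧ genus S = g) ∧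
      OnFacet (e + 2) i j S}.ncard * (g + 1) ≤ (g + 1) ^ e := by
  set A := {S : AddSubmonoid ℕ | (IsNumericalSemigroup S ∧ mult S = e + 2 ∧ genus S = g) ∧
      OnFacet (e + 2) i j S} with hA
  rcases A.eq_empty_or_nonempty with hE | ⟨S₀, -, hi0, hj0, hk0, -⟩
  · simp [hE]
  set k := (i + j) % (e + 2) with hk
  have hkm : k < e + 2 := Nat.mod_lt _ (by omega)
  have hki : k ≠ i := by
    rcases lt_or_ge (i + j) (e + 2) with h | h
    · rw [Nat.mod_eq_of_lt h] at hk; omega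
    · rw [Nat.mod_eq_sub_mod h, Nat.mod_eq_of_lt (by omega)] at hk; omega
  have hkj : k ≠ j := by
    rcases lt_or_ge (i + j) (e + 2) with h | h
    · rw [Nat.mod_eq_of_lt h] at hk; omega
    · rw [Nat.mod_eq_sub_mod h, Nat.mod_eq_of_lt (by omega)] at hk; omega
  have hsub : ({0, i, k} : Finset ℕ) ⊆ Finset.range (e + 2) := by
    intro t ht
    simp only [Finset.mem_insert, Finset.mem_singleton] at ht
    rw [Finset.mem_range]
    omega
  set T := Finset.range (e + 2) \ {0, i, k} with hT
  have hcard3 : ({0, i, k} : Finset ℕ).card = 3 :=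
    Finset.card_eq_three.2 ⟨0, i, k, hi0.symm, hk0.symm, hki.symm, rfl⟩
  have hTcard : T.card + 1 = e := by
    have h1 := Finset.card_sdiff_add_card_eq_card hsub
    rw [hcard3, Finset.card_range] at h1
    rw [hT]
    omega
  have hinj : Set.InjOn (fun (S : AddSubmonoid ℕ) (t : T) =>
      Fin.ofNat (g + 1) (kunz (e + 2) S t)) A := by
    rintro S ⟨⟨hS, hmS, hg⟩, -, -, -, hF⟩ S' ⟨⟨hS', hmS', hg'⟩, -, -, -, hF'⟩ heq
    have hmem : e + 2 ∈ S := by rw [← hmS]; exact mult_mem (by omega)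
    have hmem' : e + 2 ∈ S' := by rw [← hmS']; exact mult_mem (by omega)
    have hTeq : ∀ t ∈ T, kunz (e + 2) S t = kunz (e + 2) S' t := by
      intro t ht
      have ht' : t < e + 2 := Finset.mem_range.1 (Finset.mem_sdiff.1 ht).1
      have h1 := congrArg Fin.val (congrFun heq ⟨t, ht⟩)
      have h2 := kunz_le_genus ht' hS hmem
      have h3 := kunz_le_genus ht' hS' hmem'
      simpa [Fin.ofNat, Nat.mod_eq_of_lt (show kunz (e + 2) S t < g + 1 by omega),
        Nat.mod_eq_of_lt (show kunz (e + 2) S' t < g + 1 by omega)] using h1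
    have hsum : ∀ c : ℕ → ℕ, ∑ t ∈ Finset.range (e + 2), c t =
        ∑ t ∈ T, c t + (c 0 + (c i + c k)) := by
      intro c
      rw [← Finset.sum_sdiff hsub, Finset.sum_insert, Finset.sum_insert, Finset.sum_singleton]
      · simpa using hki.symm
      · simpa using ⟨hi0.symm, hk0.symm⟩
    have hs := genus_eq_sum_kunz (by omega) hS hmem
    have hs' := genus_eq_sum_kunz (by omega) hS' hmem'
    rw [hsum, kunz_zero, hg] at hs
    rw [hsum, kunz_zero, hg'] at hs'
    have hTsum : ∑ t ∈ T, kunz (e + 2) S t = ∑ t ∈ T, kunz (e + 2) S' t :=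
      Finset.sum_congr rfl hTeq
    have hj' : j = i ∨ kunz (e + 2) S j = kunz (e + 2) S' j := by
      by_cases hji : j = i
      · exact Or.inl hji
      · refine Or.inr (hTeq j ?_)
        simp [hT, hj, hj0, hji, hkj.symm]
    have hik : kunz (e + 2) S i = kunz (e + 2) S' i ∧ kunz (e + 2) S k = kunz (e + 2) S' k := by
      rw [← hk] at hF hF'
      generalize (i + j) / (e + 2) = E at hF hF'
      clear_value k
      rcases hj' with rfl | hj' <;> omega
    refine eq_of_kunz_eq (by omega) hS hmem hS' hmem' fun t ht => ?_
    by_cases htT : t ∈ T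
    · exact hTeq t htT
    · have : t = 0 ∨ t = i ∨ t = k := by
        by_contra hcon
        exact htT (by simpa [hT, ht] using hcon)
      rcases this with rfl | rfl | rfl
      · simp [kunz_zero]
      · exact hik.1
      · exact hik.2
  have hle := Set.ncard_le_ncard_of_injOn _ (fun S _ => Set.mem_univ _) hinj Set.finite_univ
  rw [Set.ncard_univ, Nat.card_eq_fintype_card, Fintype.card_fun, Fintype.card_fin,
    Fintype.card_coe] at hle
  calc A.ncard * (g + 1) ≤ (g + 1) ^ T.card * (g + 1) := Nat.mul_le_mul_right _ hle
    _ = (g + 1) ^ e := by rw [← pow_succ, hTcard]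

theorem ncard_not_isAHF_mul_le (e g : ℕ) :
    {S : AddSubmonoid ℕ | (IsNumericalSemigroup S ∧ mult S = e + 2 ∧ genus S = g) ∧
      ¬ IsAHF S}.ncard * (g + 1) ≤ (e + 2) ^ 2 * (g + 1) ^ e := by
  set P := Finset.range (e + 2) ×ˢ Finset.range (e + 2) with hP
  set A : ℕ × ℕ → Set (AddSubmonoid ℕ) := fun p =>
    {S | (IsNumericalSemigroup S ∧ mult S = e + 2 ∧ genus S = g) ∧
      OnFacet (e + 2) p.1 p.2 S} with hA
  have hfin := finite_setOf_mult_genus (m := e + 2) (by omega) g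
  have hsub : {S : AddSubmonoid ℕ | (IsNumericalSemigroup S ∧ mult S = e + 2 ∧ genus S = g) ∧
      ¬ IsAHF S} ⊆ ⋃ p ∈ P, A p := by
    rintro S ⟨⟨hS, hm, hg⟩, hn⟩
    obtain ⟨i, hi, j, hj, hF⟩ := exists_onFacet_of_not_isAHF hS (by omega) hn
    rw [hm] at hi hj hF
    simp only [Set.mem_iUnion]
    exact ⟨(i, j), by simp [hP, hi, hj], ⟨hS, hm, hg⟩, hF⟩
  have hle : {S : AddSubmonoid ℕ | (IsNumericalSemigroup S ∧ mult S = e + 2 ∧ genus S = g) ∧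
      ¬ IsAHF S}.ncard ≤ ∑ p ∈ P, (A p).ncard := by
    refine (Set.ncard_le_ncard hsub ?_).trans (Finset.set_ncard_biUnion_le P A)
    exact hfin.subset (Set.iUnion₂_subset fun p _ S hS => hS.1)
  calc _ ≤ (∑ p ∈ P, (A p).ncard) * (g + 1) := Nat.mul_le_mul_right _ hle
    _ = ∑ p ∈ P, (A p).ncard * (g + 1) := Finset.sum_mul ..
    _ ≤ ∑ p ∈ P, (g + 1) ^ e := by
        refine Finset.sum_le_sum fun p hp => ?_
        rw [hP, Finset.mem_product, Finset.mem_range, Finset.mem_range] at hp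
        exact ncard_onFacet_mul_le hp.1 hp.2 g
    _ = (e + 2) ^ 2 * (g + 1) ^ e := by simp [hP, sq]

/-! ### Lower bound for the total count -/

/-- The numerical semigroup whose Kunz coordinates are `c`, when these lie in `[b, 2 * b]`. -/
def ofKunz (m b : ℕ) (c : ℕ → ℕ) (h0 : c 0 = 0) (hb : ∀ t < m, t ≠ 0 → b ≤ c t)
    (hb' : ∀ t < m, c t ≤ 2 * b) (hm : 0 < m) : AddSubmonoid ℕ where
  carrier := {n | c (n % m) ≤ n / m}
  zero_mem' := by simp [h0]
  add_mem' := by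
    intro x y hx hy
    simp only [Set.mem_ofPred_eq] at hx hy ⊢
    -- The carry only helps, so it is dropped; for nonzero residues b + b already dominates every
    -- coordinate.
    refine le_trans ?_ ((add_le_add hx hy).trans (Nat.div_add_div_le_add_div))
    by_cases hx0 : x % m = 0
    · rw [Nat.add_mod, hx0, h0, zero_add, zero_add, Nat.mod_mod]
    by_cases hy0 : y % m = 0
    · rw [Nat.add_mod, hy0, h0, add_zero, add_zero, Nat.mod_mod]
    have h1 := hb _ (Nat.mod_lt x hm) hx0
    have h2 := hb _ (Nat.mod_lt y hm) hy0
    have h3 := hb' _ (Nat.mod_lt (x + y) hm)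
    omega

theorem mult_ofKunz {m b : ℕ} {c : ℕ → ℕ} (h0 : c 0 = 0) (hb : ∀ t < m, t ≠ 0 → b ≤ c t)
    (hb' : ∀ t < m, c t ≤ 2 * b) (hm : 0 < m) (hbpos : 0 < b) :
    mult (ofKunz m b c h0 hb hb' hm) = m := by
  have hmem : m ∈ {x : ℕ | x ∈ ofKunz m b c h0 hb hb' hm ∧ x ≠ 0} := by
    refine ⟨?_, hm.ne'⟩
    change c (m % m) ≤ m / m
    simp [h0]
  refine le_antisymm (Nat.sInf_le hmem) (le_csInf ⟨m, hmem⟩ ?_)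
  rintro x ⟨hx, hx0⟩
  by_contra! hlt
  change c (x % m) ≤ x / m at hx
  rw [Nat.mod_eq_of_lt hlt, Nat.div_eq_of_lt hlt] at hx
  have := hb x hlt hx0
  omega

/-- Kunz coordinates close to `q`, with total `(e + 1) * q + s`, obtained by moving `f i` from the
coordinate at `i + 1` to the last one. -/
def nearConst (e q s : ℕ) {R : ℕ} (f : Fin e → Fin R) (t : ℕ) : ℕ :=
  if t = 0 then 0 else if h : t - 1 < e then q - f ⟨t - 1, h⟩ else q + s + ∑ i, (f i : ℕ)

theorem sum_nearConst {e q s R : ℕ} (hR : R ≤ q) (f : Fin e → Fin R) :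
    ∑ t ∈ Finset.range (e + 2), nearConst e q s f t = (e + 1) * q + s := by
  rw [Finset.sum_range_succ, Finset.sum_range_succ', Finset.sum_range]
  have h1 : ∀ i : Fin e, nearConst e q s f (i + 1) = q - f i := fun i => by simp [nearConst]
  have h2 : nearConst e q s f (e + 1) = q + s + ∑ i, (f i : ℕ) := by simp [nearConst]
  have h3 : ∑ i : Fin e, (q - (f i : ℕ)) + ∑ i : Fin e, (f i : ℕ) = e * q := by
    rw [← Finset.sum_add_distrib, Finset.sum_congr rfl
      (fun i _ => Nat.sub_add_cancel ((f i).2.le.trans hR))]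
    simp
  have h4 : nearConst e q s f 0 = 0 := by simp [nearConst]
  simp only [h1, h2, h4, add_mul, one_mul]
  omega

theorem pow_le_numSemigroups {e g R : ℕ} (hR : 0 < R) (hg : (e + 1) * ((2 * e + 3) * R) ≤ g) :
    R ^ e ≤ numSemigroups (e + 2) g := by
  set q := g / (e + 1) with hq
  set s := g % (e + 1) with hs
  have hgq : (e + 1) * q + s = g := Nat.div_add_mod _ _
  have hse : s ≤ e := Nat.lt_succ_iff.1 (Nat.mod_lt g (Nat.succ_pos e))
  have hqR : (2 * e + 3) * R ≤ q := by
    rw [hq, Nat.le_div_iff_mul_le (Nat.succ_pos e)]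
    linarith
  have heR : e ≤ e * R := Nat.le_mul_of_pos_right e hR
  -- This makes the largest possible coordinate, at most q + e + e * R, fit below 2 * (q - R).
  have hqR' : 2 * (e * R) + 3 * R ≤ q := by linarith
  have hlow : ∀ f : Fin e → Fin R, ∀ t < e + 2, t ≠ 0 → q - R ≤ nearConst e q s f t := by
    intro f t _ ht0
    unfold nearConst
    rw [if_neg ht0]
    split_ifs with h
    · have := (f ⟨t - 1, h⟩).2
      omega
    · omega
  have hupp : ∀ f : Fin e → Fin R, ∀ t < e + 2, nearConst e q s f t ≤ 2 * (q - R) := by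
    intro f t _
    have hsum : ∑ i, (f i : ℕ) ≤ e * R := by
      simpa using Finset.sum_le_card_nsmul Finset.univ (fun i => (f i : ℕ)) R
        (fun i _ => (f i).2.le)
    unfold nearConst
    split_ifs with h0 h
    · omega
    · omega
    · omega
  have hzero : ∀ f : Fin e → Fin R, nearConst e q s f 0 = 0 := fun f => by simp [nearConst]
  let F : (Fin e → Fin R) → AddSubmonoid ℕ := fun f =>
    ofKunz (e + 2) (q - R) (nearConst e q s f) (hzero f) (hlow f) (hupp f) (Nat.succ_pos _)
  have hmemF : ∀ f n, n ∈ F f ↔ nearConst e q s f (n % (e + 2)) ≤ n / (e + 2) :=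
    fun f n => Iff.rfl
  have hmaps : ∀ f ∈ (Set.univ : Set (Fin e → Fin R)), F f ∈
      {S : AddSubmonoid ℕ | IsNumericalSemigroup S ∧ mult S = e + 2 ∧ genus S = g} := by
    intro f _
    obtain ⟨h1, h2⟩ := ncard_compl_of_mem_iff (Nat.succ_pos _) (hmemF f)
    refine ⟨h1, mult_ofKunz _ _ _ _ (by omega), ?_⟩
    rw [genus, h2, sum_nearConst (by omega), hgq]
  have hinj : Set.InjOn F Set.univ := by
    intro f _ f' _ hff
    ext i
    have hi : (i : ℕ) + 1 < e + 2 := by omega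
    -- Membership along the class of i + 1 reads off the coordinate q - f i.
    have key : ∀ k : ℕ, q - f i ≤ k ↔ q - f' i ≤ k := by
      intro k
      have h := (hmemF f ((e + 2) * k + (i + 1))).symm.trans
        ((iff_of_eq (congrArg (_ ∈ ·) hff)).trans (hmemF f' ((e + 2) * k + (i + 1))))
      rw [Nat.mul_add_mod, Nat.mod_eq_of_lt hi, Nat.mul_add_div (Nat.succ_pos _), Nat.div_eq_of_lt hi] at h
      simpa [nearConst] using h
    have h1 := (key (q - f i)).1 le_rfl
    have h2 := (key (q - f' i)).2 le_rfl
    have h3 := (f i).2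
    have h4 := (f' i).2
    omega
  have hle := Set.ncard_le_ncard_of_injOn F hmaps hinj
    (finite_setOf_mult_genus (m := e + 2) (by omega) g)
  rwa [Set.ncard_univ, Nat.card_eq_fintype_card, Fintype.card_fun, Fintype.card_fin,
    Fintype.card_fin] at hle

/-! ### Comparison of the two counts -/

theorem numAHF_add_ncard_not_isAHF {m : ℕ} (hm : m ≠ 0) (g : ℕ) :
    numAHF m g + {S : AddSubmonoid ℕ | (IsNumericalSemigroup S ∧ mult S = m ∧ genus S = g) ∧
      ¬ IsAHF S}.ncard = numSemigroups m g := by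
  have hfin := finite_setOf_mult_genus hm g
  rw [numAHF, numSemigroups, ← Set.ncard_union_eq _
    (hfin.subset fun S hS => ⟨hS.1, hS.2.1, hS.2.2.1⟩) (hfin.subset fun S hS => hS.1)]
  · congr 1
    ext S
    simp only [Set.mem_union, Set.mem_ofPred_eq]
    tauto
  · rw [Set.disjoint_left]
    exact fun S hS hS' => hS'.2 hS.2.2.2

/-- The proportion of semigroups that are not Apéry half-factorial is at most a constant over
`g / ((e + 1) * (2 * e + 3))`. -/
theorem one_sub_le_numAHF_div {e g : ℕ} (hR : 0 < g / ((e + 1) * (2 * e + 3))) :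
    1 - ((e + 2) ^ 2 * (2 * ((e + 1) * (2 * e + 3))) ^ e : ℕ) /
      ((g / ((e + 1) * (2 * e + 3)) : ℕ) : ℝ) ≤
      (numAHF (e + 2) g : ℝ) / (numSemigroups (e + 2) g : ℝ) := by
  set D := (e + 1) * (2 * e + 3) with hD
  set R := g / D with hRdef
  have hDpos : 0 < D := by positivity
  have hDR : D * R ≤ g := Nat.mul_div_le g D
  have hn : R ^ e ≤ numSemigroups (e + 2) g :=
    pow_le_numSemigroups hR (by rw [← mul_assoc, ← hD]; exact hDR)
  have hnpos : 0 < numSemigroups (e + 2) g := (pow_pos hR e).trans_le hn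
  -- As R ≥ 1, rounding down in g / D costs at most a factor 2.
  have hg1 : g + 1 ≤ 2 * D * R := by
    have h1 : g < D * (R + 1) := Nat.lt_mul_div_succ g hDpos
    have h2 : D ≤ D * R := Nat.le_mul_of_pos_right D hR
    rw [mul_add, mul_one] at h1
    rw [mul_assoc]
    omega
  have hRg : R ≤ g + 1 := (Nat.div_le_self g D).trans (Nat.le_succ g)
  have hadd := numAHF_add_ncard_not_isAHF (m := e + 2) (by omega) g
  have hbad := ncard_not_isAHF_mul_le e g
  set N := {S : AddSubmonoid ℕ | (IsNumericalSemigroup S ∧ mult S = e + 2 ∧ genus S = g) ∧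
      ¬ IsAHF S}.ncard
  have hNR : N * R ≤ (e + 2) ^ 2 * (2 * D) ^ e * numSemigroups (e + 2) g :=
    calc N * R ≤ N * (g + 1) := Nat.mul_le_mul_left _ hRg
      _ ≤ (e + 2) ^ 2 * (g + 1) ^ e := hbad
      _ ≤ (e + 2) ^ 2 * (2 * D * R) ^ e := by gcongr
      _ = (e + 2) ^ 2 * (2 * D) ^ e * R ^ e := by rw [mul_pow (2 * D) R e, mul_assoc]
      _ ≤ _ := Nat.mul_le_mul_left _ hn
  have hNR' : (N : ℝ) * R ≤ ((e + 2) ^ 2 * (2 * D) ^ e : ℕ) * numSemigroups (e + 2) g := by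
    exact_mod_cast hNR
  have hadd' : (numAHF (e + 2) g : ℝ) = numSemigroups (e + 2) g - N := by
    rw [← hadd]; push_cast; ring
  have hnR : (0 : ℝ) < numSemigroups (e + 2) g := by exact_mod_cast hnpos
  have hRR : (0 : ℝ) < R := by exact_mod_cast hR
  rw [hadd', sub_div, div_self hnR.ne']
  refine sub_le_sub_left ?_ 1
  rwa [div_le_div_iff₀ hnR hRR]

end NumSgp

theorem theorem4p1 (m : ℕ) (hm : 2 ≤ m) :
    Tendsto (fun g : ℕ => (NumSgp.numAHF m g : ℝ) / (NumSgp.numSemigroups m g : ℝ))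
      atTop (𝓝 1) := by
  obtain ⟨e, rfl⟩ : ∃ e, m = e + 2 := ⟨m - 2, by omega⟩
  have hR : Tendsto (fun g : ℕ => g / ((e + 1) * (2 * e + 3))) atTop atTop :=
    Nat.tendsto_div_const_atTop (by positivity)
  have hlow : Tendsto (fun g : ℕ => 1 - (((e + 2) ^ 2 * (2 * ((e + 1) * (2 * e + 3))) ^ e : ℕ) : ℝ)
      / ((g / ((e + 1) * (2 * e + 3)) : ℕ) : ℝ)) atTop (𝓝 1) := by
    simpa only [sub_zero, Function.comp_apply] using (((tendsto_natCast_atTop_atTop (R := ℝ)).comp hR).const_div_atTop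
      (((e + 2) ^ 2 * (2 * ((e + 1) * (2 * e + 3))) ^ e : ℕ) : ℝ)).const_sub 1
  refine tendsto_of_tendsto_of_tendsto_of_le_of_le' hlow tendsto_const_nhds ?_ ?_
  · filter_upwards [hR.eventually_gt_atTop 0] with g hg
    exact NumSgp.one_sub_le_numAHF_div hg
  · refine Eventually.of_forall fun g => div_le_one_of_le₀ ?_ (Nat.cast_nonneg _)
    have := NumSgp.numAHF_add_ncard_not_isAHF (m := e + 2) (by omega) g
    exact_mod_cast (by omega : NumSgp.numAHF (e + 2) g ≤ NumSgp.numSemigroups (e + 2) g)
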